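/- Let $p$ be a prime, let $\nu\ge 1$ and $k\ge 0$ be integers, and let $A$ be a finite abelian group, written additively, of order $m$ with $p\nmid m$. For a finite abelian group $G$, an abelian code in the group algebra $\mathbb{F}_{p^\nu}[G]$ is an ideal $C$ of $\mathbb{F}_{p^\nu}[G]$; its Euclidean dual is $C^{\perp_{\rm E}}=\{v\in\mathbb{F}_{p^\nu}[G] : \sum_{g\in G}c_gv_g=0 \text{ for all } c\in C\}$, and its Euclidean hull is $\mathcal{H}_{\rm E}(C)=C\cap C^{\perp_{\rm E}}$. Let $$\mathrm{avg}^{\rm E}_{p^\nu}(G)=\frac{1}{|\mathcal{C}(p^\nu,G)|}\sum_{C\in\mathcal{C}(p^\nu,G)}\dim_{\mathbb{F}_{p^\nu}}\mathcal{H}_{\rm E}(C),$$ where $\mathcal{C}(p^\nu,G)$ is the (finite) set of all abelian codes in $\mathbb{F}_{p^\nu}[G]$. For $a\in A$ let $S_{p^\nu}(a)=\{p^{\nu i}\cdot a : i=0,1,2,\dots\}$, and let $Q_{p^\nu}(A)=\{a\in A : -a\in S_{p^\nu}(a)\}$. Then $$\mathrm{avg}^{\rm E}_{p^\nu}(A\times\mathbb{Z}_{p^k})=mp^k\left(\frac13-\frac{1}{6(p^k+1)}\right)-|Q_{p^\nu}(A)|\left(\frac{p^k+1}{12}+\frac{2-3\delta}{12(p^k+1)}\right),$$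 where $\delta=1$ if $p=2$ and $k\ge1$ (that is, if $p^k$ is even), and $\delta=0$ otherwise. -/

import Mathlib

namespace AbelianCode

open scoped BigOperators

noncomputable section

/-- The abelian codes in the group algebra `F[G]`: its ideals. -/
abbrev Code (F G : Type*) [Field F] [AddCommGroup G] : Type _ :=
  Ideal (AddMonoidAlgebra F G)

/-- The Euclidean inner product `∑ g, u_g v_g` on `F[G]`. -/
def euclideanInner {F G : Type*} [Field F] [AddCommGroup G] [Fintype G]
    (u v : AddMonoidAlgebra F G) : F :=
  ∑ g : G, u.coeff g * v.coeff g

/-- The Euclidean dual `{v | ⟨c, v⟩ = 0 for all c ∈ C}`, as an `F`-subspace of `F[G]`. -/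
def euclideanDual {F G : Type*} [Field F] [AddCommGroup G] [Fintype G]
    (C : Code F G) : Submodule F (AddMonoidAlgebra F G) where
  carrier := {v | ∀ c ∈ C, euclideanInner c v = 0}
  zero_mem' := by
    intro c _
    simp [euclideanInner]
  add_mem' := by
    intro v w hv hw c hc
    have h1 := hv c hc
    have h2 := hw c hc
    simp only [euclideanInner] at h1 h2 ⊢
    simp [mul_add, Finset.sum_add_distrib, h1, h2]
  smul_mem' := by
    intro r v hv c hc
    have h1 := hv c hc
    simp only [euclideanInner] at h1 ⊢
    simp [mul_left_comm _ r, ← Finset.mul_sum, h1]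

/-- The Euclidean hull, the intersection of a code with its Euclidean dual. -/
def euclideanHull {F G : Type*} [Field F] [AddCommGroup G] [Fintype G]
    (C : Code F G) : Submodule F (AddMonoidAlgebra F G) :=
  Submodule.restrictScalars F C ⊓ euclideanDual C

/-- Over a finite field there are only finitely many abelian codes. -/
instance finite_code (F G : Type*) [Field F] [AddCommGroup G] [Finite F] [Finite G] :
    Finite (Code F G) := by
  have h : Finite (AddMonoidAlgebra F G) :=
    Finite.of_injective (fun u : AddMonoidAlgebra F G => (u.coeff : G → F)) (by
      intro u v huv
      exact AddMonoidAlgebra.coeff_injective (DFunLike.coe_injective huv))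
  exact Finite.of_injective (fun C : Code F G => (C : Set (AddMonoidAlgebra F G)))
    SetLike.coe_injective

/-- The average dimension of the Euclidean hulls of all abelian codes in `F[G]`
(the sum is a finite sum, since there are finitely many codes). -/
def avgEuclideanHullDim (F G : Type*) [Field F] [Finite F] [AddCommGroup G] [Fintype G] : ℚ :=
  (∑ᶠ C : Code F G, (Module.finrank F (euclideanHull C) : ℚ)) / (Nat.card (Code F G) : ℚ)

/-- The `q`-cyclotomic class `{q ^ i • a | i = 0, 1, …}` of `A` containing `a`. -/
def cyclotomicClass {A : Type*} [AddCommGroup A] (q : ℕ) (a : A) : Set A :=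
  {b | ∃ i : ℕ, b = (q ^ i) • a}

/-- The set `Q_q(A)` of the elements `a` of `A` whose negative lies in the class of `a`. -/
def selfNegSet (q : ℕ) (A : Type*) [AddCommGroup A] : Set A :=
  {a | -a ∈ cyclotomicClass q a}

/-- The parity correction: `1` if `p ^ k` is even (that is, `p = 2` and `1 ≤ k`), `0` otherwise. -/
def parityDelta (p k : ℕ) : ℚ :=
  if p = 2 ∧ 1 ≤ k then 1 else 0

end

end AbelianCode

/-!
Write `N = p ^ k`, `S = F[A]`, `R = F[A × ℤ/N]`, and `t = x - 1` for the generator `x` of `ℤ/N`.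
Since `p ∤ |A|`, the ring `S` is a finite product of fields, one for each maximal ideal `M` of `S`;
since `t ^ N = x ^ N - 1 = 0`, and no lower power of `t` is annihilated by a nonzero element of `S`,
the ring `R` is the product of the local rings with residue fields `S ⧸ M` and maximal ideals
generated by `t`, of length `N` (`isUniserialSystem`). In such a ring an ideal is given by a vector
of exponents `f M ∈ {0, …, N}`, one power of `t` for each component
(`IsUniserialSystem.exponentIdeal_bijective`), and its dimension is `∑ M, (N - f M) * dim (S ⧸ M)`
(`IsUniserialSystem.finrank_exponentIdeal`).

The Euclidean dual of an ideal is the conjugate, under `g ↦ -g`, of its annihilator. Conjugation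
permutes the maximal ideals of `S`, say by `σ`, and sends `t` to a unit multiple of itself, so the
dual of the ideal with exponents `f` has exponents `N - f ∘ σ`, and the hull has exponents
`max f (N - f ∘ σ)` (`euclideanHull_exponentIdeal`). Averaging over all `f` is a computation with
independent uniform exponents: each `M` with `σ M ≠ M` contributes the mean of `min a b` for
independent `a`, `b`, and each `M` with `σ M = M` the mean of `min a (N - a)`, weighted by the degree
of `S ⧸ M` (`average_exponents`).

It remains to add up the degrees. The degree of `S ⧸ M` is the number of characters of `A`, with
values in an algebraic closure of `F`, whose extension to `S` has kernel `M`. Two characters have the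
same kernel if and only if they differ by a power of the Frobenius (`ker_eq_ker_iff`), so the kernel
of `χ` is self-conjugate if and only if `χ⁻¹ = χ ^ q ^ i` for some `i`, where `q = |F|`. As the group
of characters is isomorphic to `A`, the degrees add up to `|A|` over all `M`, and to the number of
self-negative elements of `A` over the self-conjugate `M` (`sum_finrank_quotient_conjMaximal_eq`).
-/

open Finset

namespace AbelianCode

/-! ### Ideals of a product of local rings with principal nilpotent maximal ideals -/

/-- A commutative ring presented as a finite product of local rings with principal nilpotent
maximal ideals, all of the same length `N`: the `ε i` are the primitive idempotents, `t` generates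
the nilradical, and on each component `t` has nilpotency index exactly `N`. -/
structure IsUniserialSystem {R ι : Type*} [CommRing R] [Fintype ι]
    (ε : ι → R) (t : R) (N : ℕ) : Prop where
  idem : CompleteOrthogonalIdempotents ε
  pow_eq_zero : t ^ N = 0
  mul_pow_ne_zero : ∀ i, ε i * t ^ (N - 1) ≠ 0
  isMaximal : ∀ i, (Ideal.span {t, 1 - ε i}).IsMaximal

/-- The ideal of all `r` whose `i`-th component `ε i * r` is divisible by `t ^ f i`, for every
`i`. -/
def exponentIdeal {R ι : Type*} [CommRing R] (ε : ι → R) (t : R) (f : ι → ℕ) : Ideal R where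
  carrier := {r | ∀ i, t ^ f i ∣ ε i * r}
  zero_mem' := by simp
  add_mem' := by
    intro a b ha hb i
    rw [mul_add]
    exact dvd_add (ha i) (hb i)
  smul_mem' := by
    intro c a ha i
    rw [smul_eq_mul, mul_left_comm]
    exact (ha i).mul_left c

section

variable {R ι : Type*} [CommRing R] {ε : ι → R} {t : R} {N : ℕ}

theorem mem_exponentIdeal {f : ι → ℕ} {r : R} :
    r ∈ exponentIdeal ε t f ↔ ∀ i, t ^ f i ∣ ε i * r := Iff.rfl

theorem exponentIdeal_inf (f g : ι → ℕ) :
    exponentIdeal ε t f ⊓ exponentIdeal ε t g = exponentIdeal ε t (fun i => max (f i) (g i)) := by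
  ext r
  simp only [Submodule.mem_inf, mem_exponentIdeal, ← forall_and]
  refine forall_congr' fun i => ⟨fun h => ?_, fun h => ⟨?_, ?_⟩⟩
  · rcases max_cases (f i) (g i) with h' | h' <;> rw [h'.1]
    exacts [h.1, h.2]
  · exact (pow_dvd_pow t (le_max_left _ _)).trans h
  · exact (pow_dvd_pow t (le_max_right _ _)).trans h

theorem exponentIdeal_anti {f g : ι → ℕ} (hfg : ∀ i, f i ≤ g i) :
    exponentIdeal ε t g ≤ exponentIdeal ε t f :=
  fun _ hr i => (pow_dvd_pow t (hfg i)).trans (hr i)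

/-- If `t ^ n` does not divide `x`, then the highest power of `t` dividing `x` is a lower one. -/
theorem exists_pow_dvd_and_not_pow_succ_dvd {n : ℕ} {x : R} (hx : ¬ t ^ n ∣ x) :
    ∃ j < n, t ^ j ∣ x ∧ ¬ t ^ (j + 1) ∣ x := by
  classical
  have hex : ∃ n, ¬ t ^ n ∣ x := ⟨n, hx⟩
  have hpos : Nat.find hex ≠ 0 := by
    intro h0
    exact Nat.find_spec hex (by rw [h0, pow_zero]; exact one_dvd _)
  have hle := Nat.find_min' hex hx
  refine ⟨Nat.find hex - 1, by omega, not_not.1 (Nat.find_min hex (by omega)), ?_⟩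
  rw [Nat.sub_add_cancel (Nat.one_le_iff_ne_zero.2 hpos)]
  exact Nat.find_spec hex

variable [Fintype ι]

namespace IsUniserialSystem

variable (h : IsUniserialSystem ε t N)
include h

theorem idem_mul_self (i : ι) : ε i * ε i = ε i := h.idem.idem i

theorem mul_of_ne {i j : ι} (hij : i ≠ j) : ε i * ε j = 0 := h.idem.ortho hij

theorem ne_zero (i : ι) : ε i ≠ 0 := fun h0 => h.mul_pow_ne_zero i (by rw [h0, zero_mul])

theorem sum_mul (r : R) : ∑ i, ε i * r = r := by
  rw [← Finset.sum_mul, h.idem.complete, one_mul]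

/-- If the `i`-th component of `r` is divisible by `t ^ j` and no further, then it generates the
same ideal as `ε i * t ^ j`: the cofactor is a unit of the local ring at `i`. -/
theorem dvd_of_not_dvd {i : ι} {j : ℕ} {r : R} (h1 : t ^ j ∣ ε i * r)
    (h2 : ¬ t ^ (j + 1) ∣ ε i * r) : r ∣ ε i * t ^ j := by
  obtain ⟨s, hs⟩ := h1
  have he := h.idem_mul_self i
  have hsM : s ∉ Ideal.span {t, 1 - ε i} := by
    intro hmem
    obtain ⟨a, b, hab⟩ := Ideal.mem_span_pair.1 hmem
    refine h2 ⟨ε i * a, ?_⟩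
    linear_combination (-r) * he + ε i * hs - ε i * t ^ j * hab - t ^ j * b * he
  obtain ⟨u, v, hv, huv⟩ := (h.isMaximal i).exists_inv hsM
  obtain ⟨a, b, hab⟩ := Ideal.mem_span_pair.1 hv
  have hnil : IsNilpotent (a * t) := (Commute.all a t).isNilpotent_mul_left ⟨N, h.pow_eq_zero⟩
  obtain ⟨w, hw⟩ := hnil.isUnit_one_sub.exists_right_inv
  refine ⟨w * u * ε i, ?_⟩
  linear_combination (-ε i * t ^ j) * hw - w * t ^ j * ε i * huv - u * w * ε i * hs
    - w * t ^ j * ε i * hab + (u * w * r - w * t ^ j * b) * he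

theorem mul_pow_ne_zero_of_lt {i : ι} {j : ℕ} (hj : j < N) : ε i * t ^ j ≠ 0 := by
  intro h0
  apply h.mul_pow_ne_zero i
  rw [show N - 1 = j + (N - 1 - j) by omega, pow_add, ← mul_assoc, h0, zero_mul]

theorem mul_pow_mem_exponentIdeal {f : ι → ℕ} {i : ι} (hf : f i ≤ N) {a : ℕ} :
    ε i * t ^ a ∈ exponentIdeal ε t f ↔ f i ≤ a := by
  rw [mem_exponentIdeal]
  constructor
  · intro hmem
    by_contra! hlt
    obtain ⟨c, hc⟩ := (pow_dvd_pow t (Nat.succ_le_of_lt hlt)).trans (hmem i)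
    rw [← mul_assoc, h.idem_mul_self] at hc
    apply h.mul_pow_ne_zero i
    have e1 : N - 1 = a + (N - 1 - a) := by omega
    have e2 : N = a.succ + (N - 1 - a) := by omega
    have h0 : t ^ a.succ * t ^ (N - 1 - a) = 0 := by rw [← pow_add, ← e2, h.pow_eq_zero]
    rw [e1, pow_add, ← mul_assoc, hc]
    linear_combination c * h0
  · intro hle j
    rcases eq_or_ne j i with rfl | hne
    · rw [← mul_assoc, h.idem_mul_self]
      exact (pow_dvd_pow t hle).mul_left _
    · rw [← mul_assoc, h.mul_of_ne hne, zero_mul]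
      exact dvd_zero _

theorem exponentIdeal_injective {f g : ι → ℕ} (hf : ∀ i, f i ≤ N) (hg : ∀ i, g i ≤ N)
    (hfg : exponentIdeal ε t f = exponentIdeal ε t g) : f = g := by
  funext i
  refine le_antisymm ?_ ?_
  · rw [← h.mul_pow_mem_exponentIdeal (hf i), hfg, h.mul_pow_mem_exponentIdeal (hg i)]
  · rw [← h.mul_pow_mem_exponentIdeal (hg i), ← hfg, h.mul_pow_mem_exponentIdeal (hf i)]

theorem mem_of_mem_exponentIdeal {f : ι → ℕ} {I : Ideal R} (hI : ∀ i, ε i * t ^ f i ∈ I) {r : R}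
    (hr : r ∈ exponentIdeal ε t f) : r ∈ I := by
  rw [← h.sum_mul r]
  refine I.sum_mem fun i _ => ?_
  obtain ⟨c, hc⟩ := hr i
  have : ε i * r = c * (ε i * t ^ f i) := by
    linear_combination (-r) * h.idem_mul_self i + ε i * hc
  rw [this]
  exact I.mul_mem_left _ (hI i)

theorem exists_exponentIdeal_eq (I : Ideal R) :
    ∃ f : ι → ℕ, (∀ i, f i ≤ N) ∧ exponentIdeal ε t f = I := by
  classical
  have hex : ∀ i, ∃ a, ε i * t ^ a ∈ I := fun i => ⟨N, by simp [h.pow_eq_zero]⟩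
  refine ⟨fun i => Nat.find (hex i),
    fun i => Nat.find_min' (hex i) (by simp [h.pow_eq_zero]), le_antisymm ?_ ?_⟩
  · exact fun r hr => h.mem_of_mem_exponentIdeal (fun i => Nat.find_spec (hex i)) hr
  · intro r hr i
    by_contra hnot
    obtain ⟨j, hj, h1, h2⟩ := exists_pow_dvd_and_not_pow_succ_dvd hnot
    obtain ⟨c, hc⟩ := h.dvd_of_not_dvd h1 h2
    exact Nat.find_min (hex i) hj (hc ▸ I.mul_mem_right c hr)

/-- Ideals correspond to vectors of exponents in `{0, …, N}`. -/
theorem exponentIdeal_bijective :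
    Function.Bijective fun f : ι → Fin (N + 1) => exponentIdeal ε t (fun i => (f i : ℕ)) := by
  constructor
  · intro f g hfg
    have := h.exponentIdeal_injective (fun i => Nat.lt_succ_iff.1 (f i).2)
      (fun i => Nat.lt_succ_iff.1 (g i).2) hfg
    funext i
    exact Fin.ext (congrFun this i)
  · intro I
    obtain ⟨f, hf, hI⟩ := h.exists_exponentIdeal_eq I
    exact ⟨fun i => ⟨f i, Nat.lt_succ_iff.2 (hf i)⟩, hI⟩

/-- On a component, `t ^ a` and `t ^ (N - a)` are annihilators of each other. -/
theorem mul_pow_eq_zero_iff {i : ι} {a : ℕ} {r : R} (ha : a ≤ N) :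
    ε i * r * t ^ a = 0 ↔ t ^ (N - a) ∣ ε i * r := by
  constructor
  · intro h0
    by_contra hnot
    obtain ⟨j, hj, h1, h2⟩ := exists_pow_dvd_and_not_pow_succ_dvd hnot
    obtain ⟨c, hc⟩ := h.dvd_of_not_dvd h1 h2
    refine h.mul_pow_ne_zero_of_lt (i := i) (j := j + a) (by omega) ?_
    rw [pow_add]
    linear_combination (-t ^ j * t ^ a) * h.idem_mul_self i + ε i * t ^ a * hc + c * h0
  · rintro ⟨c, hc⟩
    have h0 : t ^ (N - a) * t ^ a = 0 := by
      rw [← pow_add, Nat.sub_add_cancel ha, h.pow_eq_zero]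
    rw [hc]
    linear_combination c * h0

/-- Duality of exponent ideals: if an involution of `R` permutes the primitive idempotents by `σ`
and preserves `t` up to a unit, then the conjugate of the annihilator of the ideal with
exponents `f` has exponents `N - f ∘ σ`. -/
theorem forall_map_mul_eq_zero_iff {Φ : Type*} [FunLike Φ R R] [RingHomClass Φ R R] {φ : Φ}
    (hφ : ∀ r, φ (φ r) = r) {σ : ι → ι}
    (hσ : ∀ i, φ (ε i) = ε (σ i)) (ht : Associated (φ t) t) {f : ι → ℕ} (hf : ∀ i, f i ≤ N)
    {v : R} :
    (∀ c ∈ exponentIdeal ε t f, c * φ v = 0) ↔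
      v ∈ exponentIdeal ε t (fun i => N - f (σ i)) := by
  have hσσ : ∀ i, σ (σ i) = i := by
    intro i
    by_contra hne
    have h1 : ε (σ (σ i)) = ε i := by rw [← hσ, ← hσ, hφ]
    have h2 := h.mul_of_ne hne
    rw [h1, h.idem_mul_self] at h2
    exact h.ne_zero i h2
  have key : ∀ i, ε i * t ^ f i * φ v = 0 ↔ ε (σ i) * v * t ^ f i = 0 := by
    intro i
    obtain ⟨u, hu⟩ := ht
    have hinj : Function.Injective φ := fun a b hab => by rw [← hφ a, hab, hφ]
    rw [← hinj.eq_iff, map_zero, map_mul, map_mul, map_pow, hφ, hσ]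
    have hu' : t ^ f i = φ t ^ f i * (u ^ f i : Rˣ) := by
      rw [Units.val_pow_eq_pow_val, ← mul_pow, hu]
    rw [hu', ← mul_assoc, Units.mul_left_eq_zero, mul_right_comm]
  calc (∀ c ∈ exponentIdeal ε t f, c * φ v = 0)
      ↔ ∀ i, ε i * t ^ f i * φ v = 0 := by
        constructor
        · exact fun hc i => hc _ ((h.mul_pow_mem_exponentIdeal (hf i)).2 le_rfl)
        · intro hi c hc
          have := h.mem_of_mem_exponentIdeal
            (I := LinearMap.ker (LinearMap.mulRight R (φ v))) (fun i => by simpa using hi i) hc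
          simpa using this
    _ ↔ ∀ i, ε (σ i) * v * t ^ f i = 0 := forall_congr' key
    _ ↔ ∀ i, ε i * v * t ^ f (σ i) = 0 :=
        ⟨fun hi i => by simpa [hσσ] using hi (σ i), fun hi i => by simpa [hσσ] using hi (σ i)⟩
    _ ↔ v ∈ exponentIdeal ε t (fun i => N - f (σ i)) :=
        forall_congr' fun i => h.mul_pow_eq_zero_iff (hf _)

theorem exponentIdeal_const : exponentIdeal ε t (fun _ => N) = ⊥ := by
  rw [eq_bot_iff]
  intro r hr
  rw [Submodule.mem_bot, ← h.sum_mul r]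
  refine Finset.sum_eq_zero fun i _ => ?_
  have := hr i
  rwa [h.pow_eq_zero, zero_dvd_iff] at this

/-- Multiplication by `ε i * t ^ f i` identifies the residue field at `i` with the quotient of the
exponent ideals of `f` and of `f` raised by one at `i`. -/
theorem mul_pow_mul_mem_iff [DecidableEq ι] {f : ι → ℕ} {i : ι} (hi : f i < N) {r : R} :
    ε i * t ^ f i * r ∈ exponentIdeal ε t (Function.update f i (f i + 1)) ↔
      r ∈ Ideal.span {t, 1 - ε i} := by
  have he := h.idem_mul_self i
  constructor
  · intro hmem
    by_contra hr
    obtain ⟨u, v, hv, huv⟩ := (h.isMaximal i).exists_inv hr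
    obtain ⟨a, b, hab⟩ := Ideal.mem_span_pair.1 hv
    have h1 : ε i * t ^ f i ∈ exponentIdeal ε t (Function.update f i (f i + 1)) := by
      have e : ε i * t ^ f i = u * (ε i * t ^ f i * r) + a * (ε i * t ^ (f i + 1)) := by
        linear_combination (-ε i * t ^ f i) * huv - ε i * t ^ f i * hab - b * t ^ f i * he
      rw [e]
      refine Ideal.add_mem _ (Ideal.mul_mem_left _ _ hmem) (Ideal.mul_mem_left _ _ ?_)
      refine (h.mul_pow_mem_exponentIdeal ?_).2 ?_ <;> (simp; try omega)
    rw [h.mul_pow_mem_exponentIdeal (by simp; omega)] at h1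
    simp at h1
  · intro hr
    obtain ⟨a, b, hab⟩ := Ideal.mem_span_pair.1 hr
    have e : ε i * t ^ f i * r = a * (ε i * t ^ (f i + 1)) := by
      linear_combination (-ε i * t ^ f i) * hab - b * t ^ f i * he
    rw [e]
    refine Ideal.mul_mem_left _ _ ((h.mul_pow_mem_exponentIdeal ?_).2 ?_) <;> (simp; try omega)

/-- The ideal with exponents `f` has a filtration whose factors are, for each `i`, `N - f i` copies
of the residue field at `i`. -/
theorem finrank_exponentIdeal (F : Type*) [Field F] [Algebra F R] [FiniteDimensional F R]
    {f : ι → ℕ} (hf : ∀ i, f i ≤ N) :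
    Module.finrank F ((exponentIdeal ε t f).restrictScalars F) =
      ∑ i, (N - f i) * Module.finrank F (R ⧸ Ideal.span {t, 1 - ε i}) := by
  classical
  -- Raising one exponent by one cuts the ideal down by one copy of the residue field.
  induction hn : ∑ i, (N - f i) generalizing f with
  | zero =>
    have hfN : f = fun _ => N := by
      funext i
      have := (Finset.sum_eq_zero_iff.1 hn) i (mem_univ i)
      have := hf i
      omega
    subst hfN
    rw [h.exponentIdeal_const]
    simp only [Submodule.restrictScalars_bot, Nat.sub_self, zero_mul, Finset.sum_const_zero]
    exact finrank_bot F R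
  | succ n ih =>
    obtain ⟨i, hi⟩ : ∃ i, f i < N := by
      by_contra! hall
      have : ∑ i, (N - f i) = 0 := Finset.sum_eq_zero fun i _ => by have := hall i; omega
      omega
    set g := Function.update f i (f i + 1) with hg
    have hgN : ∀ j, g j ≤ N := by
      intro j
      rcases eq_or_ne j i with rfl | hne
      · simp [hg]; omega
      · simp [hg, hne, hf j]
    have hfg : ∀ j, f j ≤ g j := by
      intro j
      rcases eq_or_ne j i with rfl | hne
      · simp [hg]
      · simp [hg, hne]
    have hsum : ∀ w : ι → ℕ, ∑ j, (N - f j) * w j = ∑ j, (N - g j) * w j + w i := by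
      intro w
      rw [← Finset.add_sum_erase _ _ (mem_univ i), ← Finset.add_sum_erase univ _ (mem_univ i)]
      have : ∑ j ∈ univ.erase i, (N - g j) * w j = ∑ j ∈ univ.erase i, (N - f j) * w j :=
        Finset.sum_congr rfl fun j hj => by simp [hg, Finset.ne_of_mem_erase hj]
      rw [this, show N - f i = (N - g i) + 1 by simp [hg]; omega]
      ring
    have hgn : ∑ j, (N - g j) = n := by
      have := hsum fun _ => 1
      simp only [mul_one] at this
      omega
    set P := (exponentIdeal ε t f).restrictScalars F
    set Q := (exponentIdeal ε t g).restrictScalars F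
    have hQP : Q ≤ P := exponentIdeal_anti hfg
    let φ : R →ₗ[F] R ⧸ Q := Q.mkQ ∘ₗ LinearMap.mulLeft F (ε i * t ^ f i)
    have hker : LinearMap.ker φ = (Ideal.span {t, 1 - ε i}).restrictScalars F := by
      ext r
      simp only [φ, LinearMap.mem_ker, LinearMap.comp_apply, Submodule.mkQ_apply,
        Submodule.Quotient.mk_eq_zero, LinearMap.mulLeft_apply, Q, Submodule.restrictScalars_mem]
      exact h.mul_pow_mul_mem_iff hi
    let θ : P →ₗ[F] R ⧸ Q := Q.mkQ.domRestrict P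
    have hθker : LinearMap.ker θ = Q.comap P.subtype := by
      ext r
      simp [θ, LinearMap.mem_ker]
    have hrange : LinearMap.range θ = LinearMap.range φ := by
      apply le_antisymm
      · rintro _ ⟨⟨r, hr⟩, rfl⟩
        obtain ⟨c, hc⟩ := (show r ∈ exponentIdeal ε t f from hr) i
        refine ⟨c, ?_⟩
        simp only [φ, θ, LinearMap.comp_apply, LinearMap.domRestrict_apply, Submodule.mkQ_apply,
          LinearMap.mulLeft_apply]
        rw [Submodule.Quotient.eq]
        intro j
        have he := h.idem_mul_self i
        rcases eq_or_ne j i with rfl | hne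
        · have : ε j * (ε j * t ^ f j * c - r) = 0 := by
            linear_combination (t ^ f j * c) * he - ε j * hc + r * he
          rw [this]; exact dvd_zero _
        · have : ε j * (ε i * t ^ f i * c - r) = - (ε j * r) := by
            linear_combination (t ^ f i * c) * h.mul_of_ne hne
          rw [this, dvd_neg, hg, Function.update_of_ne hne]
          exact hr j
      · rintro _ ⟨r, rfl⟩
        exact ⟨⟨ε i * t ^ f i * r, Ideal.mul_mem_right _ _
          ((h.mul_pow_mem_exponentIdeal (hf i)).2 le_rfl)⟩, rfl⟩
    have h1 := LinearMap.finrank_range_add_finrank_ker θ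
    have h2 : Module.finrank F (LinearMap.ker θ) = Module.finrank F Q := by
      rw [hθker]
      exact (Submodule.comapSubtypeEquivOfLe hQP).finrank_eq
    have h3 : Module.finrank F (LinearMap.range φ) =
        Module.finrank F (R ⧸ Ideal.span {t, 1 - ε i}) := by
      rw [← φ.quotKerEquivRange.finrank_eq, hker]
      rfl
    rw [hsum, ← ih hgN hgn, ← h1, h2, hrange, h3]
    ring

end IsUniserialSystem

end

/-! ### Averages over vectors of exponents -/

section

variable {ι β : Type*} [Fintype ι] [DecidableEq ι] [Fintype β] [Nonempty β]

/-- One coordinate of a uniformly random function is uniformly distributed. -/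
theorem average_apply (i : ι) (φ : β → ℚ) :
    (∑ f : ι → β, φ (f i)) / Fintype.card (ι → β) = (∑ b, φ b) / Fintype.card β := by
  have hsum : ∑ f : ι → β, φ (f i) = ∑ b, Fintype.card ({j // j ≠ i} → β) * φ b := by
    rw [← (Equiv.funSplitAt i β).symm.sum_comp, Fintype.sum_prod_type]
    simp
  have hcard : Fintype.card (ι → β) = Fintype.card β * Fintype.card ({j // j ≠ i} → β) := by
    rw [Fintype.card_congr (Equiv.funSplitAt i β), Fintype.card_prod]
  have h1 : (Fintype.card ({j // j ≠ i} → β) : ℚ) ≠ 0 := Nat.cast_ne_zero.2 Fintype.card_ne_zero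
  rw [hsum, hcard, ← Finset.mul_sum, Nat.cast_mul, mul_comm (Fintype.card β : ℚ),
    mul_div_mul_left _ _ h1]

/-- Two distinct coordinates of a uniformly random function are independent. -/
theorem average_apply_apply {i j : ι} (hij : j ≠ i) (φ : β → β → ℚ) :
    (∑ f : ι → β, φ (f i) (f j)) / Fintype.card (ι → β) =
      (∑ b, ∑ c, φ b c) / (Fintype.card β : ℚ) ^ 2 := by
  have hsum : ∑ f : ι → β, φ (f i) (f j) =
      ∑ b, ∑ g : {j // j ≠ i} → β, φ b (g ⟨j, hij⟩) := by
    rw [← (Equiv.funSplitAt i β).symm.sum_comp, Fintype.sum_prod_type]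
    simp [hij]
  have hcard : Fintype.card (ι → β) = Fintype.card β * Fintype.card ({j // j ≠ i} → β) := by
    rw [Fintype.card_congr (Equiv.funSplitAt i β), Fintype.card_prod]
  rw [hsum, hcard, Nat.cast_mul, mul_comm (Fintype.card β : ℚ), ← div_div, Finset.sum_div]
  simp only [average_apply]
  rw [← Finset.sum_div, div_div, sq]

end

theorem sum_range_sum_range_min (N : ℕ) :
    6 * ∑ a ∈ range (N + 1), ∑ b ∈ range (N + 1), min a b = N * (N + 1) * (2 * N + 1) := by
  induction N with
  | zero => simp
  | succ N ih =>
    have h1 : ∀ a ∈ range (N + 1), ∑ b ∈ range (N + 1 + 1), min a b =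
        ∑ b ∈ range (N + 1), min a b + a := by
      intro a ha
      rw [sum_range_succ, min_eq_left (by have := mem_range.1 ha; omega)]
    have h2 : ∑ b ∈ range (N + 1 + 1), min (N + 1) b = ∑ b ∈ range (N + 2), b :=
      sum_congr rfl fun b hb => min_eq_right (by have := mem_range.1 hb; omega)
    have h3 := Finset.sum_range_id_mul_two (N + 1)
    have h4 := Finset.sum_range_id_mul_two (N + 2)
    simp only [Nat.add_sub_cancel, show N + 2 - 1 = N + 1 by omega] at h3 h4
    rw [sum_range_succ, sum_congr rfl h1, sum_add_distrib, h2]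
    linarith

theorem sum_range_min_sub (N : ℕ) :
    4 * ∑ a ∈ range (N + 1), min a (N - a) + N % 2 = N ^ 2 := by
  induction N using Nat.twoStepInduction with
  | zero => simp
  | one => decide
  | more N ih _ =>
    have h1 : ∀ a ∈ range (N + 1), min (a + 1) (N + 2 - (a + 1)) = min a (N - a) + 1 := by
      intro a ha
      have := mem_range.1 ha
      omega
    rw [sum_range_succ, sum_range_succ', sum_congr rfl h1, sum_add_distrib]
    simp
    linarith

/-- The average of `∑ i, d i * (N - max (f i) (N - f (σ i)))` over all `f : ι → {0, …, N}`: a fixed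
point of `σ` contributes the mean of `min a (N - a)`, any other point the mean of `min a b` for
independent uniform `a` and `b`. -/
theorem average_exponents {ι : Type*} [Fintype ι] [DecidableEq ι] (σ : ι → ι) (d : ι → ℕ) (N : ℕ) :
    (∑ f : ι → Fin (N + 1), ((∑ i, (N - max (f i : ℕ) (N - f (σ i))) * d i : ℕ) : ℚ)) /
        Fintype.card (ι → Fin (N + 1)) =
      ((∑ i, d i : ℕ) : ℚ) * (N * (2 * N + 1) / (6 * (N + 1)))
        - ((∑ i with σ i = i, d i : ℕ) : ℚ) *
          (N * (2 * N + 1) / (6 * (N + 1)) - (N ^ 2 - (N % 2 : ℕ)) / (4 * (N + 1))) := by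
  have hN : (N + 1 : ℚ) ≠ 0 := by positivity
  have hself : ∀ i, σ i = i →
      (∑ f : ι → Fin (N + 1), ((N - max (f i : ℕ) (N - f (σ i)) : ℕ) : ℚ)) /
        Fintype.card (ι → Fin (N + 1)) = (N ^ 2 - (N % 2 : ℕ)) / (4 * (N + 1)) := by
    intro i hi
    rw [hi, average_apply i fun b : Fin (N + 1) => ((N - max (b : ℕ) (N - b) : ℕ) : ℚ),
      Fin.sum_univ_eq_sum_range (fun b => ((N - max b (N - b) : ℕ) : ℚ)) (N + 1)]
    have h1 : ∑ b ∈ range (N + 1), ((N - max b (N - b) : ℕ) : ℚ) =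
        ((∑ a ∈ range (N + 1), min a (N - a) : ℕ) : ℚ) := by
      push_cast
      refine sum_congr rfl fun a ha => ?_
      have := mem_range.1 ha
      exact_mod_cast (by omega : N - max a (N - a) = min a (N - a))
    have h2 : (4 * ((∑ a ∈ range (N + 1), min a (N - a) : ℕ) : ℚ) + (N % 2 : ℕ) : ℚ) = N ^ 2 := by
      exact_mod_cast sum_range_min_sub N
    rw [h1, Fintype.card_fin, ← h2]
    push_cast
    field_simp
    ring
  have hpair : ∀ i, σ i ≠ i →
      (∑ f : ι → Fin (N + 1), ((N - max (f i : ℕ) (N - f (σ i)) : ℕ) : ℚ)) /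
        Fintype.card (ι → Fin (N + 1)) = N * (2 * N + 1) / (6 * (N + 1)) := by
    intro i hi
    rw [average_apply_apply hi
      fun b c : Fin (N + 1) => ((N - max (b : ℕ) (N - c) : ℕ) : ℚ)]
    have h1 : ∑ b : Fin (N + 1), ∑ c : Fin (N + 1), ((N - max (b : ℕ) (N - c) : ℕ) : ℚ) =
        ((∑ a ∈ range (N + 1), ∑ b ∈ range (N + 1), min a b : ℕ) : ℚ) := by
      rw [← sum_range_reflect]
      push_cast
      rw [Fin.sum_univ_eq_sum_range
        (fun b => ∑ c : Fin (N + 1), ((N - max b (N - c) : ℕ) : ℚ)) (N + 1)]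
      refine sum_congr rfl fun a ha => ?_
      rw [Fin.sum_univ_eq_sum_range (fun c => ((N - max a (N - c) : ℕ) : ℚ)) (N + 1)]
      refine sum_congr rfl fun b hb => ?_
      have h1 := mem_range.1 ha
      have h2 := mem_range.1 hb
      exact_mod_cast (by omega : N - max a (N - b) = min (N + 1 - 1 - a) b)
    have h2 : (6 * ((∑ a ∈ range (N + 1), ∑ b ∈ range (N + 1), min a b : ℕ) : ℚ)) =
        N * (N + 1) * (2 * N + 1) := by
      exact_mod_cast sum_range_sum_range_min N
    rw [h1, Fintype.card_fin, div_eq_div_iff (by positivity) (by positivity)]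
    push_cast at h2 ⊢
    linear_combination (N + 1 : ℚ) * h2
  have hsplit : (∑ f : ι → Fin (N + 1), ((∑ i, (N - max (f i : ℕ) (N - f (σ i))) * d i : ℕ) : ℚ)) /
      Fintype.card (ι → Fin (N + 1)) = ∑ i, (d i : ℚ) *
        ((∑ f : ι → Fin (N + 1), ((N - max (f i : ℕ) (N - f (σ i)) : ℕ) : ℚ)) /
          Fintype.card (ι → Fin (N + 1))) := by
    simp only [← mul_div_assoc, Finset.mul_sum, ← Finset.sum_div]
    rw [Finset.sum_comm]
    congr 1
    refine sum_congr rfl fun f _ => ?_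
    push_cast
    exact sum_congr rfl fun i _ => mul_comm _ _
  rw [hsplit, Finset.sum_filter]
  push_cast
  rw [Finset.sum_mul, Finset.sum_mul, ← Finset.sum_sub_distrib]
  refine sum_congr rfl fun i _ => ?_
  by_cases hi : σ i = i
  · rw [hself i hi, if_pos hi]; ring
  · rw [hpair i hi, if_neg hi]; ring

/-! ### Characters and residue fields of the semisimple group algebra -/

noncomputable section

section

variable {F S : Type*} [Field F] [CommRing S] [Algebra F S] [FiniteDimensional F S]

theorem isMaximal_ker_algHom (χ : S →ₐ[F] AlgebraicClosure F) : (RingHom.ker χ).IsMaximal := by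
  have : IsArtinianRing S := IsArtinianRing.of_finite F S
  have : (RingHom.ker χ).IsPrime := RingHom.ker_isPrime χ.toRingHom
  exact IsArtinianRing.isMaximal_of_isPrime (RingHom.ker χ)

variable [Finite F]

/-- The homomorphisms of `F`-algebras with kernel a given maximal ideal `M` are the embeddings of
its residue field, and there are as many as the degree of that field. -/
theorem card_algHom_ker_eq (M : MaximalSpectrum S) :
    Nat.card {χ : S →ₐ[F] AlgebraicClosure F // RingHom.ker χ = M.asIdeal} =
      Module.finrank F (S ⧸ M.asIdeal) := by
  let : Field (S ⧸ M.asIdeal) := Ideal.Quotient.field M.asIdeal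
  rw [← Field.finSepDegree_eq_finrank_of_isSeparable,
    Field.finSepDegree_eq_of_isAlgClosed F _ (AlgebraicClosure F)]
  refine Nat.card_congr
    { toFun := fun χ => Ideal.Quotient.liftₐ M.asIdeal χ.1 fun a ha => by
        rwa [← χ.2, RingHom.mem_ker] at ha
      invFun := fun φ => ⟨φ.comp (Ideal.Quotient.mkₐ F M.asIdeal), ?_⟩
      left_inv := fun χ => Subtype.ext (AlgHom.ext fun _ => rfl)
      right_inv := fun φ => Ideal.Quotient.algHom_ext _ (AlgHom.ext fun _ => rfl) }
  ext a
  have hinj : Function.Injective φ := φ.toRingHom.injective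
  rw [RingHom.mem_ker, AlgHom.comp_apply, map_eq_zero_iff φ hinj, Ideal.Quotient.mkₐ_eq_mk,
    Ideal.Quotient.eq_zero_iff_mem]

theorem sum_finrank_quotient_eq_card_algHom [Fintype (MaximalSpectrum S)]
    (T : MaximalSpectrum S → Prop) [DecidablePred T] :
    ∑ M with T M, Module.finrank F (S ⧸ M.asIdeal) =
      Nat.card {χ : S →ₐ[F] AlgebraicClosure F // T ⟨RingHom.ker χ, isMaximal_ker_algHom χ⟩} := by
  classical
  have := Fintype.ofFinite (S →ₐ[F] AlgebraicClosure F)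
  rw [Nat.card_eq_fintype_card, Fintype.card_subtype, Finset.card_eq_sum_card_fiberwise
    (f := fun χ => (⟨RingHom.ker χ, isMaximal_ker_algHom χ⟩ : MaximalSpectrum S))
    (t := univ.filter T) (fun χ hχ => by simpa using hχ)]
  refine sum_congr rfl fun M hM => ?_
  rw [← card_algHom_ker_eq, Nat.card_eq_fintype_card, Fintype.card_subtype, Finset.filter_filter]
  congr 1
  ext χ
  simp only [mem_filter, mem_univ, true_and, MaximalSpectrum.ext_iff] at hM ⊢
  constructor
  · intro h
    have hM' : (⟨RingHom.ker χ, isMaximal_ker_algHom χ⟩ : MaximalSpectrum S) = M :=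
      MaximalSpectrum.ext h
    exact ⟨hM' ▸ hM, h⟩
  · exact fun h => h.2

/-- Two homomorphisms of `F`-algebras into an algebraic closure have the same kernel if and only
if they differ by a power of the Frobenius. -/
theorem ker_eq_ker_iff (φ ψ : S →ₐ[F] AlgebraicClosure F) :
    RingHom.ker ψ = RingHom.ker φ ↔ ∃ i : ℕ, ∀ x, ψ x = φ x ^ Nat.card F ^ i := by
  have := Fintype.ofFinite F
  rw [Nat.card_eq_fintype_card]
  constructor
  · intro hker
    have hmax := isMaximal_ker_algHom φ
    set M := RingHom.ker φ
    let : Field (S ⧸ M) := Ideal.Quotient.field M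
    have : Finite (S ⧸ M) := Module.finite_of_finite F
    let φ' : S ⧸ M →ₐ[F] AlgebraicClosure F := Ideal.Quotient.liftₐ M φ fun a ha => ha
    let ψ' : S ⧸ M →ₐ[F] AlgebraicClosure F := Ideal.Quotient.liftₐ M ψ fun a ha => by
      rwa [← hker, RingHom.mem_ker] at ha
    have hinj : Function.Injective fun n : Fin (Module.finrank F (S ⧸ M)) =>
        φ'.comp (FiniteField.frobeniusAlgHom F (S ⧸ M) ^ n.1) := by
      intro a b hab
      apply (FiniteField.bijective_frobeniusAlgHom_pow F (S ⧸ M)).1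
      refine AlgHom.ext fun x => φ'.toRingHom.injective ?_
      exact DFunLike.congr_fun hab x
    have hcard : Nat.card (S ⧸ M →ₐ[F] AlgebraicClosure F) = Module.finrank F (S ⧸ M) := by
      rw [← Field.finSepDegree_eq_of_isAlgClosed, Field.finSepDegree_eq_finrank_of_isSeparable]
    have hbij := hinj.bijective_of_nat_card_le (by rw [hcard, Nat.card_fin])
    obtain ⟨n, hn⟩ := hbij.2 ψ'
    refine ⟨n, fun x => ?_⟩
    have h1 : ψ x = ψ' (Ideal.Quotient.mk M x) := rfl
    have h2 : φ x = φ' (Ideal.Quotient.mk M x) := rfl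
    rw [h1, h2, ← hn, AlgHom.comp_apply, AlgHom.coe_pow, FiniteField.coe_frobeniusAlgHom,
      pow_iterate, map_pow]
  · rintro ⟨i, hi⟩
    ext x
    rw [RingHom.mem_ker, RingHom.mem_ker, hi, pow_eq_zero_iff (pow_ne_zero _ Fintype.card_ne_zero)]

end

/-- The conjugation of a group algebra: the linear extension of `g ↦ -g`. -/
def conj (F G : Type*) [Field F] [AddCommGroup G] :
    AddMonoidAlgebra F G ≃ₐ[F] AddMonoidAlgebra F G :=
  AddMonoidAlgebra.domCongr F F (AddEquiv.neg G)

section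

variable {F G : Type*} [Field F] [AddCommGroup G]

theorem algHom_ext_single {B : Type*} [CommRing B] [Algebra F B]
    {φ ψ : AddMonoidAlgebra F G →ₐ[F] B}
    (h : ∀ g, φ (AddMonoidAlgebra.single g 1) = ψ (AddMonoidAlgebra.single g 1)) : φ = ψ :=
  (AddMonoidAlgebra.lift F B G).symm.injective (MonoidHom.ext fun a => h a.toAdd)

theorem coeff_conj (x : AddMonoidAlgebra F G) (g : G) : (conj F G x).coeff g = x.coeff (-g) := by
  simp [conj]

theorem conj_single (g : G) (c : F) :
    conj F G (AddMonoidAlgebra.single g c) = AddMonoidAlgebra.single (-g) c := by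
  simp [conj]

theorem conj_conj (x : AddMonoidAlgebra F G) : conj F G (conj F G x) = x := by
  ext g
  simp [coeff_conj]

/-- Conjugation of maximal ideals of a group algebra. -/
def conjMaximal (F A : Type*) [Field F] [AddCommGroup A]
    (M : MaximalSpectrum (AddMonoidAlgebra F A)) : MaximalSpectrum (AddMonoidAlgebra F A) :=
  ⟨M.asIdeal.comap (conj F A), have := M.isMaximal
    Ideal.comap_isMaximal_of_surjective _ (conj F A).surjective⟩

end

section

variable {F A : Type*} [Field F] [Finite F] [AddCommGroup A] [Finite A]

/-- The group algebra of a group of order prime to the characteristic is reduced: some power of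
the Frobenius is the identity. -/
theorem isReduced_addMonoidAlgebra (h : (Nat.card F).Coprime (Nat.card A)) :
    IsReduced (AddMonoidAlgebra F A) := by
  have := Fintype.ofFinite F
  rw [Nat.card_eq_fintype_card] at h
  set q := Fintype.card F
  set n := (Nat.card A).totient
  have hn : n ≠ 0 := (Nat.totient_pos.2 Nat.card_pos).ne'
  have hid : FiniteField.frobeniusAlgHom F (AddMonoidAlgebra F A) ^ n = AlgHom.id F _ := by
    refine algHom_ext_single fun a : A => ?_
    rw [AlgHom.coe_pow, FiniteField.coe_frobeniusAlgHom, pow_iterate, AlgHom.id_apply]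
    beta_reduce
    rw [AddMonoidAlgebra.single_pow, one_pow]
    congr 1
    have hmod : q ^ n ≡ 1 [MOD Nat.card A] := Nat.ModEq.pow_totient h
    have := (hmod.of_dvd (addOrderOf_dvd_natCard a))
    rw [← one_nsmul a, ← mul_nsmul', mul_one]
    exact nsmul_eq_nsmul_iff_modEq.2 this
  have hpow : ∀ x : AddMonoidAlgebra F A, x ^ q ^ n = x := by
    intro x
    have := DFunLike.congr_fun hid x
    rwa [AlgHom.coe_pow, FiniteField.coe_frobeniusAlgHom, pow_iterate] at this
  have hq : 1 < q ^ n := Nat.one_lt_pow hn Fintype.one_lt_card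
  refine (isReduced_iff_pow_one_lt _ hq).2 fun x hx => ?_
  rw [← hpow x, hx]

/-- The characters of `A` in an algebraic closure form a group isomorphic to `A`. -/
theorem exists_equiv_algHom (h : (Nat.card F).Coprime (Nat.card A)) :
    ∃ e : (AddMonoidAlgebra F A →ₐ[F] AlgebraicClosure F) ≃ A,
      (∀ χ, e (χ.comp (conj F A : AddMonoidAlgebra F A →ₐ[F] AddMonoidAlgebra F A)) = - e χ) ∧
      ∀ (χ ψ) (n : ℕ), (∀ x, ψ x = χ x ^ Nat.card F ^ n) ↔ e ψ = Nat.card F ^ n • e χ := by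
  have hne : NeZero (Monoid.exponent (Multiplicative A) : F) := by
    refine ⟨fun h0 => ?_⟩
    have := Fintype.ofFinite F
    rw [Nat.card_eq_fintype_card] at h
    have hcop : (Fintype.card F).Coprime (Monoid.exponent (Multiplicative A)) :=
      h.coprime_dvd_right (Group.exponent_dvd_nat_card (G := Multiplicative A))
    have h1 : ringChar F ∣ Monoid.exponent (Multiplicative A) := (ringChar.spec F _).1 h0
    have h2 : ringChar F ∣ Fintype.card F := (ringChar.spec F _).1 (Nat.cast_card_eq_zero F)
    exact CharP.ringChar_ne_one (Nat.eq_one_of_dvd_coprimes hcop h2 h1)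
  obtain ⟨g⟩ := CommGroup.monoidHom_mulEquiv_of_hasEnoughRootsOfUnity (Multiplicative A)
    (AlgebraicClosure F)
  let c : (AddMonoidAlgebra F A →ₐ[F] AlgebraicClosure F) ≃
      (Multiplicative A →* (AlgebraicClosure F)ˣ) :=
    (AddMonoidAlgebra.lift F (AlgebraicClosure F) A).symm.trans
      MonoidHom.toHomUnitsMulEquiv.toEquiv
  have hc : ∀ χ (a : A), ((c χ (Multiplicative.ofAdd a) : (AlgebraicClosure F)ˣ) :
      AlgebraicClosure F) = χ (AddMonoidAlgebra.single a 1) := fun _ _ => rfl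
  refine ⟨c.trans (g.toEquiv.trans Multiplicative.toAdd), fun χ => ?_, fun χ ψ n => ?_⟩
  · have hinv : c (χ.comp (conj F A : AddMonoidAlgebra F A →ₐ[F] AddMonoidAlgebra F A)) =
        (c χ)⁻¹ := by
      refine MonoidHom.ext fun a => ?_
      rw [MonoidHom.inv_apply, ← map_inv]
      apply Units.ext
      rw [← ofAdd_toAdd a, ← ofAdd_neg, hc, hc, AlgHom.comp_apply]
      exact congrArg χ (conj_single _ _)
    simp only [Equiv.trans_apply, hinv, MulEquiv.toEquiv_eq_coe, MulEquiv.coe_toEquiv]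
    exact congrArg Multiplicative.toAdd (map_inv g (c χ))
  · have hpow : (∀ x, ψ x = χ x ^ Nat.card F ^ n) ↔ c ψ = c χ ^ Nat.card F ^ n := by
      constructor
      · intro hx
        refine MonoidHom.ext fun a => Units.ext ?_
        rw [MonoidHom.pow_apply, Units.val_pow_eq_pow_val, ← ofAdd_toAdd a, hc, hc, hx]
      · intro hx
        have := Fintype.ofFinite F
        have hcomp : ψ = (FiniteField.frobeniusAlgHom F (AlgebraicClosure F) ^ n).comp χ := by
          refine algHom_ext_single fun a : A => ?_
          rw [← hc, hx, AlgHom.comp_apply, AlgHom.coe_pow, FiniteField.coe_frobeniusAlgHom,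
            pow_iterate, ← hc, MonoidHom.pow_apply, Units.val_pow_eq_pow_val,
            Nat.card_eq_fintype_card]
        intro x
        rw [hcomp, AlgHom.comp_apply, AlgHom.coe_pow, FiniteField.coe_frobeniusAlgHom,
          pow_iterate, Nat.card_eq_fintype_card]
    rw [hpow, ← g.injective.eq_iff, map_pow]
    exact Multiplicative.toAdd.injective.eq_iff.symm

theorem sum_finrank_quotient [Fintype (MaximalSpectrum (AddMonoidAlgebra F A))]
    (h : (Nat.card F).Coprime (Nat.card A)) :
    ∑ M : MaximalSpectrum (AddMonoidAlgebra F A),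
      Module.finrank F (AddMonoidAlgebra F A ⧸ M.asIdeal) = Nat.card A := by
  obtain ⟨e, -, -⟩ := exists_equiv_algHom h
  have := sum_finrank_quotient_eq_card_algHom (F := F) (S := AddMonoidAlgebra F A) fun _ => True
  rw [Finset.filter_true] at this
  rw [this, Nat.card_congr (Equiv.subtypeUnivEquiv fun _ => trivial), Nat.card_congr e]

/-- The self-conjugate maximal ideals of `F[A]` are the kernels of the characters whose inverse is
a conjugate under the Frobenius, which are parametrized by the self-negative elements of `A`. -/
theorem sum_finrank_quotient_conjMaximal_eq [Fintype (MaximalSpectrum (AddMonoidAlgebra F A))]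
    [DecidableEq (MaximalSpectrum (AddMonoidAlgebra F A))]
    (h : (Nat.card F).Coprime (Nat.card A)) :
    ∑ M with conjMaximal F A M = M, Module.finrank F (AddMonoidAlgebra F A ⧸ M.asIdeal) =
      Nat.card (selfNegSet (Nat.card F) A) := by
  obtain ⟨e, he1, he2⟩ := exists_equiv_algHom h
  rw [sum_finrank_quotient_eq_card_algHom]
  refine Nat.card_congr (e.subtypeEquiv fun χ => ?_)
  calc conjMaximal F A ⟨RingHom.ker χ, isMaximal_ker_algHom χ⟩ =
        ⟨RingHom.ker χ, isMaximal_ker_algHom χ⟩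
      ↔ RingHom.ker (χ.comp (conj F A : AddMonoidAlgebra F A →ₐ[F] AddMonoidAlgebra F A)) =
          RingHom.ker χ := MaximalSpectrum.ext_iff
    _ ↔ ∃ i : ℕ, - e χ = Nat.card F ^ i • e χ := by
        rw [ker_eq_ker_iff]
        simp only [he2, he1]
    _ ↔ e χ ∈ selfNegSet (Nat.card F) A := Iff.rfl

end

end

/-! ### Primitive idempotents of a reduced Artinian ring -/

noncomputable section

section

variable {S : Type*} [CommRing S] [IsArtinianRing S] [IsReduced S]

open Classical in
/-- The idempotent of a reduced Artinian ring that is `1` in the residue field of `M` and `0` in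
all other residue fields. -/
def primitiveIdempotent (M : MaximalSpectrum S) : S :=
  (IsArtinianRing.equivPi S).symm (Pi.single M 1)

theorem completeOrthogonalIdempotents_primitiveIdempotent [Fintype (MaximalSpectrum S)] :
    CompleteOrthogonalIdempotents (primitiveIdempotent : MaximalSpectrum S → S) := by
  classical
  have h := CompleteOrthogonalIdempotents.single fun M : MaximalSpectrum S => S ⧸ M.asIdeal
  have h' := h.map (IsArtinianRing.equivPi S).symm.toRingEquiv.toRingHom
  exact h'

theorem primitiveIdempotent_mul_eq_zero_iff {M : MaximalSpectrum S} {s : S} :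
    primitiveIdempotent M * s = 0 ↔ s ∈ M.asIdeal := by
  classical
  rw [← Ideal.Quotient.eq_zero_iff_mem, ← (IsArtinianRing.equivPi S).injective.eq_iff, map_mul, map_zero,
    primitiveIdempotent, AlgEquiv.apply_symm_apply, funext_iff]
  constructor
  · intro h
    simpa using h M
  · intro h M'
    rcases eq_or_ne M' M with rfl | hne
    · simpa using h
    · simp [hne]

/-- An involution that carries `M'` to `M` also exchanges their idempotents. -/
theorem map_primitiveIdempotent {Φ : Type*} [FunLike Φ S S] [RingHomClass Φ S S] {φ : Φ}
    (hφ : ∀ s, φ (φ s) = s) {M M' : MaximalSpectrum S}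
    (hM : ∀ s, s ∈ M'.asIdeal ↔ φ s ∈ M.asIdeal) :
    φ (primitiveIdempotent M) = primitiveIdempotent M' := by
  have := Fintype.ofFinite (MaximalSpectrum S)
  -- Idempotents with the same annihilator coincide.
  have hann : ∀ s, φ (primitiveIdempotent M) * s = 0 ↔ primitiveIdempotent M' * s = 0 := by
    intro s
    rw [primitiveIdempotent_mul_eq_zero_iff, hM, ← primitiveIdempotent_mul_eq_zero_iff]
    have hinj : Function.Injective φ := fun a b hab => by rw [← hφ a, hab, hφ]
    rw [← hinj.eq_iff, map_mul, map_zero, hφ]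
  have hid : ∀ M : MaximalSpectrum S, primitiveIdempotent M * primitiveIdempotent M =
      primitiveIdempotent M := completeOrthogonalIdempotents_primitiveIdempotent.idem
  have h1 := (hann (1 - φ (primitiveIdempotent M))).1 (by
    rw [mul_sub, mul_one, ← map_mul, hid, sub_self])
  have h2 := (hann (1 - primitiveIdempotent M')).2 (by rw [mul_sub, mul_one, hid, sub_self])
  linear_combination h2 - h1

end

/-! ### Duals and hulls of ideals of a group algebra -/

section

variable {F G : Type*} [Field F] [AddCommGroup G] [Fintype G]

theorem euclideanInner_eq_coeff_mul_conj (c v : AddMonoidAlgebra F G) :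
    euclideanInner c v = (c * conj F G v).coeff 0 := by
  rw [AddMonoidAlgebra.coeff_mul_apply_left, Finsupp.sum_fintype _ _ (by simp)]
  simp [euclideanInner, coeff_conj]

/-- The dual of a code is the conjugate of its annihilator. -/
theorem mem_euclideanDual {C : Code F G} {v : AddMonoidAlgebra F G} :
    v ∈ euclideanDual C ↔ ∀ c ∈ C, c * conj F G v = 0 := by
  have hdef : v ∈ euclideanDual C ↔ ∀ c ∈ C, euclideanInner c v = 0 := Iff.rfl
  rw [hdef]
  constructor
  · intro h c hc
    ext g
    -- The coefficient at `g` is the inner product with a translate of `c`.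
    have := h (AddMonoidAlgebra.single (-g) 1 * c) (C.mul_mem_left _ hc)
    rw [euclideanInner_eq_coeff_mul_conj, mul_assoc,
      AddMonoidAlgebra.coeff_single_mul_apply] at this
    simpa using this
  · intro h c hc
    rw [euclideanInner_eq_coeff_mul_conj, h c hc]
    rfl

theorem euclideanHull_exponentIdeal {ι : Type*} [Fintype ι] {ε : ι → AddMonoidAlgebra F G}
    {t : AddMonoidAlgebra F G} {N : ℕ} (h : IsUniserialSystem ε t N) {σ : ι → ι}
    (hσ : ∀ i, conj F G (ε i) = ε (σ i)) (ht : Associated (conj F G t) t) {f : ι → ℕ}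
    (hf : ∀ i, f i ≤ N) :
    euclideanHull (exponentIdeal ε t f) =
      (exponentIdeal ε t fun i => max (f i) (N - f (σ i))).restrictScalars F := by
  rw [← exponentIdeal_inf]
  ext v
  rw [euclideanHull, Submodule.mem_inf, mem_euclideanDual, Submodule.restrictScalars_mem,
    Submodule.restrictScalars_mem, Submodule.mem_inf]
  exact and_congr_right fun _ => h.forall_map_mul_eq_zero_iff (φ := conj F G) conj_conj hσ ht hf

/-- The average hull dimension, when the group algebra is a product of local rings with principal
maximal ideals of the same length: only the degrees of the residue fields, and which components
are fixed by conjugation, matter. -/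
theorem avgEuclideanHullDim_eq [Finite F] {ι : Type*} [Fintype ι] [DecidableEq ι]
    {ε : ι → AddMonoidAlgebra F G} {t : AddMonoidAlgebra F G} {N : ℕ}
    (h : IsUniserialSystem ε t N) {σ : ι → ι} (hσ : ∀ i, conj F G (ε i) = ε (σ i))
    (ht : Associated (conj F G t) t) (d : ι → ℕ)
    (hd : ∀ i, Module.finrank F (AddMonoidAlgebra F G ⧸ Ideal.span {t, 1 - ε i}) = d i) :
    avgEuclideanHullDim F G =
      ((∑ i, d i : ℕ) : ℚ) * (N * (2 * N + 1) / (6 * (N + 1)))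
        - ((∑ i with σ i = i, d i : ℕ) : ℚ) *
          (N * (2 * N + 1) / (6 * (N + 1)) - (N ^ 2 - (N % 2 : ℕ)) / (4 * (N + 1))) := by
  rw [← average_exponents, avgEuclideanHullDim,
    ← Nat.card_congr (Equiv.ofBijective _ h.exponentIdeal_bijective), Nat.card_eq_fintype_card,
    ← finsum_eq_of_bijective _ h.exponentIdeal_bijective fun f => rfl, finsum_eq_sum_of_fintype]
  congr 1
  refine sum_congr rfl fun f _ => ?_
  rw [euclideanHull_exponentIdeal h hσ ht fun i => Nat.lt_succ_iff.1 (f i).2,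
    h.finrank_exponentIdeal F fun i => ?_]
  · simp only [hd]
  · have := (f i).2
    omega

end

/-! ### The group algebra of `A × ℤ/p^k` -/

section

variable (F A : Type*) [Field F] [AddCommGroup A] (N : ℕ)

/-- The inclusion of `F[A]` in `F[A × ℤ/N]`. -/
def inclusion : AddMonoidAlgebra F A →ₐ[F] AddMonoidAlgebra F (A × ZMod N) :=
  AddMonoidAlgebra.mapDomainAlgHom F F (AddMonoidHom.inl A (ZMod N))

/-- The projection of `F[A × ℤ/N]` to `F[A]`. -/
def projection : AddMonoidAlgebra F (A × ZMod N) →ₐ[F] AddMonoidAlgebra F A :=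
  AddMonoidAlgebra.mapDomainAlgHom F F (AddMonoidHom.fst A (ZMod N))

/-- The generator `x - 1` of the kernel of `F[A × ℤ/N] → F[A]`, for `x` the generator of `ℤ/N`. -/
def uniformizer : AddMonoidAlgebra F (A × ZMod N) :=
  AddMonoidAlgebra.single (0, 1) 1 - 1

variable {F A N}

theorem inclusion_single (a : A) (c : F) :
    inclusion F A N (AddMonoidAlgebra.single a c) = AddMonoidAlgebra.single (a, 0) c := by
  simp [inclusion]

theorem projection_single (g : A × ZMod N) (c : F) :
    projection F A N (AddMonoidAlgebra.single g c) = AddMonoidAlgebra.single g.1 c := by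
  simp [projection]

theorem coeff_inclusion (s : AddMonoidAlgebra F A) (a : A) (j : ZMod N) :
    (inclusion F A N s).coeff (a, j) = if j = 0 then s.coeff a else 0 := by
  induction s using AddMonoidAlgebra.induction_linear with
  | zero => simp
  | add x y hx hy => rw [map_add]; simp [hx, hy]; split_ifs <;> simp
  | single b c =>
    classical
    rw [inclusion_single]
    by_cases hj : j = 0 <;> simp [Finsupp.single_apply, hj, eq_comm]

theorem projection_inclusion (s : AddMonoidAlgebra F A) :
    projection F A N (inclusion F A N s) = s := by
  induction s using AddMonoidAlgebra.induction_linear with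
  | zero => simp
  | add x y hx hy => rw [map_add, map_add, hx, hy]
  | single b c => rw [inclusion_single, projection_single]

theorem projection_uniformizer : projection F A N (uniformizer F A N) = 0 := by
  rw [uniformizer, map_sub, projection_single, map_one]
  exact sub_self _

theorem conj_inclusion (s : AddMonoidAlgebra F A) :
    conj F (A × ZMod N) (inclusion F A N s) = inclusion F A N (conj F A s) := by
  induction s using AddMonoidAlgebra.induction_linear with
  | zero => simp
  | add x y hx hy => rw [map_add, map_add, hx, hy, map_add, map_add]
  | single b c => rw [inclusion_single, conj_single, conj_single, inclusion_single]; simp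

theorem associated_conj_uniformizer :
    Associated (conj F (A × ZMod N) (uniformizer F A N)) (uniformizer F A N) := by
  have hxy : AddMonoidAlgebra.single ((0, 1) : A × ZMod N) (1 : F) *
      AddMonoidAlgebra.single (-(0, 1)) 1 = 1 := by
    rw [AddMonoidAlgebra.single_mul_single, add_neg_cancel, one_mul]
    rfl
  refine ⟨-⟨_, _, hxy, by rw [mul_comm, hxy]⟩, ?_⟩
  rw [uniformizer, map_sub, conj_single, map_one]
  simp only [Units.val_neg]
  linear_combination -hxy

theorem uniformizer_dvd_sub_one [NeZero N] (j : ZMod N) :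
    uniformizer F A N ∣ AddMonoidAlgebra.single (0, j) 1 - 1 := by
  have : (AddMonoidAlgebra.single (0, j) 1 : AddMonoidAlgebra F (A × ZMod N)) =
      AddMonoidAlgebra.single (0, 1) 1 ^ j.val := by
    rw [AddMonoidAlgebra.single_pow, one_pow]
    simp
  rw [this, uniformizer]
  exact sub_one_dvd_pow_sub_one _ _

theorem uniformizer_dvd_sub_inclusion [NeZero N] (r : AddMonoidAlgebra F (A × ZMod N)) :
    uniformizer F A N ∣ r - inclusion F A N (projection F A N r) := by
  induction r using AddMonoidAlgebra.induction_linear with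
  | zero => simp
  | add x y hx hy =>
    rw [map_add, map_add, add_sub_add_comm]
    exact dvd_add hx hy
  | single g c =>
    have : AddMonoidAlgebra.single g c - inclusion F A N (projection F A N
        (AddMonoidAlgebra.single g c)) = AddMonoidAlgebra.single (g.1, 0) c *
          (AddMonoidAlgebra.single (0, g.2) 1 - 1) := by
      rw [projection_single, inclusion_single, mul_sub, mul_one,
        AddMonoidAlgebra.single_mul_single]
      simp
    rw [this]
    exact (uniformizer_dvd_sub_one _).mul_left _

end

section

variable {F A : Type*} [Field F] [AddCommGroup A] {p : ℕ} [Fact p.Prime] [CharP F p] {k : ℕ}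

theorem uniformizer_pow_eq_zero : uniformizer F A (p ^ k) ^ p ^ k = 0 := by
  have : CharP (AddMonoidAlgebra F (A × ZMod (p ^ k))) p :=
    charP_of_injective_algebraMap (algebraMap F _).injective p
  rw [uniformizer, sub_pow_char_pow, one_pow, AddMonoidAlgebra.single_pow, one_pow]
  have : p ^ k • ((0, 1) : A × ZMod (p ^ k)) = 0 := by
    ext <;> simp
  rw [this]
  exact sub_self _

open Polynomial in
/-- In characteristic `p` one has `(X - 1) ^ (p ^ k - 1) = ∑ j < p ^ k, X ^ j`. -/
theorem sub_one_pow_prime_pow_sub_one :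
    (X - 1 : F[X]) ^ (p ^ k - 1) = ∑ j ∈ range (p ^ k), X ^ j := by
  have hX : (X - 1 : F[X]) ≠ 0 := by simpa using X_sub_C_ne_zero (1 : F)
  refine mul_right_cancel₀ hX ?_
  rw [geom_sum_mul, ← pow_succ, Nat.sub_add_cancel (Nat.one_le_pow _ _ (Fact.out : p.Prime).pos),
    sub_pow_char_pow, one_pow]

theorem uniformizer_pow_sub_one : uniformizer F A (p ^ k) ^ (p ^ k - 1) =
    ∑ j ∈ range (p ^ k), AddMonoidAlgebra.single (0, (j : ZMod (p ^ k))) 1 := by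
  have := congrArg (Polynomial.aeval (AddMonoidAlgebra.single ((0, 1) : A × ZMod (p ^ k)) (1 : F)))
    (sub_one_pow_prime_pow_sub_one (F := F) (p := p) (k := k))
  simp only [map_pow, map_sub, Polynomial.aeval_X, map_one, map_sum] at this
  rw [uniformizer, this]
  refine sum_congr rfl fun j _ => ?_
  rw [AddMonoidAlgebra.single_pow, one_pow]
  simp

/-- Multiplication by `(x - 1) ^ (p ^ k - 1)` is injective on `F[A]`: the coefficients of `s` are
among those of the product. -/
theorem inclusion_mul_uniformizer_pow_ne_zero {s : AddMonoidAlgebra F A} (hs : s ≠ 0) :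
    inclusion F A (p ^ k) s * uniformizer F A (p ^ k) ^ (p ^ k - 1) ≠ 0 := by
  intro h0
  apply hs
  ext a
  have h1 := congrArg (fun r => r.coeff (a, 0)) h0
  simp only [uniformizer_pow_sub_one, Finset.mul_sum, AddMonoidAlgebra.coeff_sum,
    Finsupp.finsetSum_apply, AddMonoidAlgebra.coeff_mul_single_apply, mul_one] at h1
  rw [Finset.sum_eq_single 0] at h1
  · simpa [coeff_inclusion] using h1
  · intro j hj hj0
    have : (j : ZMod (p ^ k)) ≠ 0 := by
      rw [Ne, ZMod.natCast_eq_zero_iff]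
      exact fun hdvd => hj0 (Nat.eq_zero_of_dvd_of_lt hdvd (mem_range.1 hj))
    simp [coeff_inclusion, this]
  · intro h
    exact absurd (mem_range.2 (Nat.pow_pos (Fact.out : p.Prime).pos)) h

variable [IsArtinianRing (AddMonoidAlgebra F A)] [IsReduced (AddMonoidAlgebra F A)]

omit [CharP F p] in
/-- The maximal ideal of `F[A × ℤ/p^k]` above `M`, in terms of the idempotent of `M`. -/
theorem span_uniformizer_eq_comap (M : MaximalSpectrum (AddMonoidAlgebra F A)) :
    Ideal.span {uniformizer F A (p ^ k), 1 - inclusion F A (p ^ k) (primitiveIdempotent M)} =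
      M.asIdeal.comap (projection F A (p ^ k)) := by
  have := Fintype.ofFinite (MaximalSpectrum (AddMonoidAlgebra F A))
  have hid : primitiveIdempotent M * primitiveIdempotent M = primitiveIdempotent M :=
    completeOrthogonalIdempotents_primitiveIdempotent.idem M
  apply le_antisymm
  · rw [Ideal.span_le]
    rintro r (rfl | rfl)
    · simp [projection_uniformizer]
    · simp only [SetLike.mem_coe, Ideal.mem_comap, map_sub, map_one, projection_inclusion]
      rw [← primitiveIdempotent_mul_eq_zero_iff, mul_sub, mul_one, hid, sub_self]
  · intro r hr
    rw [Ideal.mem_comap, ← primitiveIdempotent_mul_eq_zero_iff] at hr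
    obtain ⟨c, hc⟩ := uniformizer_dvd_sub_inclusion r
    refine Ideal.mem_span_pair.2 ⟨c, inclusion F A (p ^ k) (projection F A (p ^ k) r), ?_⟩
    have h0 := congrArg (inclusion F A (p ^ k)) hr
    rw [map_mul, map_zero] at h0
    linear_combination -h0 - hc

theorem isUniserialSystem [Fintype (MaximalSpectrum (AddMonoidAlgebra F A))] :
    IsUniserialSystem (fun M : MaximalSpectrum (AddMonoidAlgebra F A) =>
      inclusion F A (p ^ k) (primitiveIdempotent M)) (uniformizer F A (p ^ k)) (p ^ k) where
  idem := completeOrthogonalIdempotents_primitiveIdempotent.map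
    (inclusion F A (p ^ k)).toRingHom
  pow_eq_zero := uniformizer_pow_eq_zero
  mul_pow_ne_zero M := by
    refine inclusion_mul_uniformizer_pow_ne_zero fun h0 => ?_
    have h1 : (1 : AddMonoidAlgebra F A) ∈ M.asIdeal :=
      primitiveIdempotent_mul_eq_zero_iff.1 (by rw [h0, zero_mul])
    exact M.isMaximal.ne_top ((Ideal.eq_top_iff_one _).2 h1)
  isMaximal M := by
    rw [span_uniformizer_eq_comap]
    have := M.isMaximal
    exact Ideal.comap_isMaximal_of_surjective _
      (fun s => ⟨inclusion F A (p ^ k) s, projection_inclusion s⟩)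

omit [CharP F p] in
theorem finrank_quotient_span_uniformizer (M : MaximalSpectrum (AddMonoidAlgebra F A)) :
    Module.finrank F (AddMonoidAlgebra F (A × ZMod (p ^ k)) ⧸ Ideal.span
      {uniformizer F A (p ^ k), 1 - inclusion F A (p ^ k) (primitiveIdempotent M)}) =
      Module.finrank F (AddMonoidAlgebra F A ⧸ M.asIdeal) := by
  have hsurj : Function.Surjective
      ((Ideal.Quotient.mkₐ F M.asIdeal).comp (projection F A (p ^ k))) :=
    (Ideal.Quotient.mkₐ_surjective F _).comp
      (fun s => ⟨inclusion F A (p ^ k) s, projection_inclusion s⟩)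
  rw [← (Ideal.quotientKerAlgEquivOfSurjective hsurj).toLinearEquiv.finrank_eq]
  have : Ideal.span {uniformizer F A (p ^ k), 1 - inclusion F A (p ^ k) (primitiveIdempotent M)} =
      RingHom.ker ((Ideal.Quotient.mkₐ F M.asIdeal).comp (projection F A (p ^ k))) := by
    rw [span_uniformizer_eq_comap]
    ext r
    rw [RingHom.mem_ker, AlgHom.comp_apply, Ideal.Quotient.mkₐ_eq_mk,
      Ideal.Quotient.eq_zero_iff_mem, Ideal.mem_comap]
  rw [this]

/-- The average hull dimension in terms of `N = p ^ k`, before the two fractions are simplified. -/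
theorem avgEuclideanHullDim_prod_zmod [Finite F] [Fintype A]
    (hcop : (Nat.card F).Coprime (Nat.card A)) :
    avgEuclideanHullDim F (A × ZMod (p ^ k)) =
      (Nat.card A : ℚ) * ((p ^ k : ℕ) * (2 * (p ^ k : ℕ) + 1) / (6 * ((p ^ k : ℕ) + 1)))
        - (Nat.card (selfNegSet (Nat.card F) A) : ℚ) *
          ((p ^ k : ℕ) * (2 * (p ^ k : ℕ) + 1) / (6 * ((p ^ k : ℕ) + 1))
            - ((p ^ k : ℕ) ^ 2 - (p ^ k % 2 : ℕ)) / (4 * ((p ^ k : ℕ) + 1))) := by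
  classical
  have := Fintype.ofFinite (MaximalSpectrum (AddMonoidAlgebra F A))
  have hconj : ∀ M : MaximalSpectrum (AddMonoidAlgebra F A),
      conj F (A × ZMod (p ^ k)) (inclusion F A (p ^ k) (primitiveIdempotent M)) =
        inclusion F A (p ^ k) (primitiveIdempotent (conjMaximal F A M)) := fun M => by
    rw [conj_inclusion, map_primitiveIdempotent (φ := conj F A) (M' := conjMaximal F A M) conj_conj
      fun _ => Iff.rfl]
  have hsys := isUniserialSystem (F := F) (A := A) (p := p) (k := k)
  have hassoc := associated_conj_uniformizer (F := F) (A := A) (N := p ^ k)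
  have havg := avgEuclideanHullDim_eq hsys hconj hassoc
    (fun M => Module.finrank F (AddMonoidAlgebra F A ⧸ M.asIdeal)) finrank_quotient_span_uniformizer
  rw [sum_finrank_quotient hcop, sum_finrank_quotient_conjMaximal_eq hcop] at havg
  exact havg

end

end

end AbelianCode

theorem theorem4p5 (p : ℕ) [Fact p.Prime] (ν : ℕ) (hν : 0 < ν) (k : ℕ)
    {F : Type*} [Field F] [Finite F] (hF : Nat.card F = p ^ ν)
    {A : Type*} [AddCommGroup A] [Fintype A]
    (m : ℕ) (hm : Nat.card A = m) (hpm : ¬ p ∣ m) :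
    AbelianCode.avgEuclideanHullDim F (A × ZMod (p ^ k)) =
      (m : ℚ) * (p : ℚ) ^ k * (1 / 3 - 1 / (6 * ((p : ℚ) ^ k + 1)))
        - (Nat.card (AbelianCode.selfNegSet (p ^ ν) A) : ℚ) *
          (((p : ℚ) ^ k + 1) / 12
            + (2 - 3 * AbelianCode.parityDelta p k) / (12 * ((p : ℚ) ^ k + 1))) := by
  classical
  have hp : p.Prime := Fact.out
  have hchar : CharP F p := by
    have := Fintype.ofFinite F
    rw [Nat.card_eq_fintype_card] at hF
    exact charP_of_card_eq_prime_pow hF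
  have hcop : (Nat.card F).Coprime (Nat.card A) := by
    rw [hF, hm]
    exact Nat.Coprime.pow_left ν ((Nat.Prime.coprime_iff_not_dvd hp).2 hpm)
  have hart : IsArtinianRing (AddMonoidAlgebra F A) := IsArtinianRing.of_finite F _
  have hred := AbelianCode.isReduced_addMonoidAlgebra hcop
  have havg := AbelianCode.avgEuclideanHullDim_prod_zmod (F := F) (A := A) (p := p) (k := k) hcop
  rw [hm, hF] at havg
  -- The correction for odd `p ^ k` in the mean of `min a (p ^ k - a)` is what `parityDelta` records.
  have hmod : ((p ^ k % 2 : ℕ) : ℚ) = 1 - AbelianCode.parityDelta p k := by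
    unfold AbelianCode.parityDelta
    split_ifs with h
    · obtain ⟨rfl, hk⟩ := h
      rw [Nat.mod_eq_zero_of_dvd (dvd_pow_self 2 (by omega))]
      simp
    · have hodd : p ^ k % 2 = 1 := by
        rw [← Nat.odd_iff]
        rcases Nat.eq_zero_or_pos k with rfl | hk
        · simp
        · exact (hp.odd_of_ne_two fun h2 => h ⟨h2, hk⟩).pow
      rw [hodd]
      simp
  have hne : (p : ℚ) ^ k + 1 ≠ 0 := by positivity
  rw [havg, hmod]
  push_cast
  field_simp
  ring
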